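/- **Model (continuous time).** Times are $\mathbb T=\mathbb R_{\ge 0}$. A context $\gamma$ consists of: a directed graph of agents whose edges $(i,j)$ carry delivery bounds $b(i,j)\in(0,\infty]$; a state set $S_i$ for each agent $i$ with a pseudo-limit function $\lim_i:S_i^{(-1,0)}\to S_i$ (depending only on the left germ of its argument at $0$, and sending each constant function to its value); a set of external inputs, each observed by one given agent ($\tilde e$ is observed by $i_{\tilde e}$); and possibly constraints on the environment. An agent observes its external inputs, the deliveries of messages sent to it, and the rings of its own timers; it is *enabled* at $t$ if $t=0$ or $t$ is the supremum of a set of times at which it observes events. A protocol $P$ gives each agent a set of initial states and an action function which, when the agent is enabled, determines from its state just before $t$, the events it observes at $t$ and (possibly) $t$ itself its new state, the messages it sends to out-neighbours, possibly a timer, and whether it responds. In a run of $P$ (whose data include the initial states used): agents that are not enabled keep their states, enabled agents act according to $P$; each external input occurs at most once; a message sent at $t$ along $(i,j)$ is delivered exactly once, at some $t'$ with $t<t'\le t+b(i,j)$ (*early* if $t'<t+b(i,j)$), and only sent messages are delivered; a timer set at $t'$ for $t>t'$ rings at $t$ iff the agent is not enabled during $(t',t)$; the environment constraints hold; and there is no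 infinite sequence of agent-time pairs, each enabled, with strictly decreasing times and each in the syncausal past of its predecessor. Non-deterministic (ND) events are the external inputs and the early deliveries; every event $e$ has an observer $i_e$ and a time $t_e$. *Syncausality* $\rightsquigarrow_r$ is the reflexive-transitive relation on agent-time pairs generated by $(i,t)\rightsquigarrow_r(i,t')$ for $t\le t'$; $(i,t)\rightsquigarrow_r(j,t')$ if a message sent by $i$ at $t$ is delivered to $j$ at $t'$; and $(i,t)\rightsquigarrow_r(j,t+b(i,j))$ for every edge $(i,j)$ with $b(i,j)<\infty$. *Bound guarantee* $\dashrightarrow$ is generated by the first and third rules alone. For events, $e\rightsquigarrow_r\theta$ and $e\dashrightarrow\theta$ mean the same with $(i_e,t_e)$ in place of $e$, and $e\rightsquigarrow_r e'$ means that $e=e'$ or that $e'$ is the delivery of a message sent by some $i$ at some $t$ with $e\rightsquigarrow_r(i,t)$. $\mathrm{PND}_r(\theta)$ is the set of ND events $e$ of $r$ with $e\rightsquigarrow_r\theta$. $L_r(\tilde e,\theta)$ is the supremum of the number of ND events (including $\tilde e$) in a syncausal path from $\tilde e$ to $\theta$, and $\infty$ if there is no such path; $L_r(\theta',\theta)$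 is defined likewise for agent-time pairs. $\gamma$ is a *bounded-syncausal-path* context if $\theta'\rightsquigarrow_r\theta$ implies $L_r(\theta',\theta)<\infty$ for all runs $r$ of all protocols. As the continuous-time model prescribes, $P$ is assumed to satisfy *no foresight* (for each run $r$ and all $t,d\in\mathbb T$ there is a run that coincides with $r$ up to and including $t$, has no external inputs after $t$, and in which every message delivered early after $t$ is delivered at least $d$ after it was sent) and *no extrasensory perception* (for each run $r$ and each $(i,t)$ there is a run with the same initial states whose set of ND events up to $t$, with their times, is $\mathrm{PND}_r(i,t)$). **Response problems.** Let $I$ be a set of agents, $\delta$ a function from the ordered pairs of distinct elements of $I$ to $[-\infty,\infty]$, $G_\delta$ the directed graph on $I$ whose edges are the pairs with $\delta(i,j)\ne\infty$, weighted by $\delta$, and $\hat\delta(i,j)$ the infimum of the lengths of the paths in $G_\delta$ from $i$ to $j$. A run is *$\tilde e$-triggered* if $\tilde e$ occurs in it. $P$ solves $\mathrm{ER}\langle\tilde e,I\rangle$ if in every $\tilde e$-triggered run $r$ each $i\in I$ responds exactly once, at a time denoted $t_r(i)$, and no $i\in I$ responds in other runs. $P$ solves $\mathrm{TCR}\langle\tilde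 e,I,\delta\rangle$ if moreover $t_r(j)\le t_r(i)+\delta(i,j)$ for all distinct $i,j\in I$ and every triggered run $r$. An *$\tilde e$-broom* for $J$ by $(\tau_j)_{j\in J}$ in $r$ is an ND event $e$ of $r$ with $\tilde e\rightsquigarrow_r e$ and $e\dashrightarrow(j,\tau_j)$ for all $j\in J$; its *horizon* is $\max_j\tau_j$. **Corollary.** Let $P$ be a protocol solving $\mathrm{TCR}\langle\tilde e,I,\delta\rangle$, let $r$ be an $\tilde e$-triggered run of $P$, let $J\subseteq I$ be finite and contained in one strongly connected component of $G_\delta$, and let $i\in J$ be such that $L:=L_r(\tilde e,(i,t_r(i)))<\infty$. Then: 1. There is an event $e\in\mathrm{PND}_r(i,t_r(i))$ that is an $\tilde e$-broom for $J$ in $r$ with horizon at most $$t_r(i)+(|J|-1)\cdot L\cdot\max(\hat\delta|_{J^2})<\infty .$$ 2. If, in addition, $\hat\delta|_{J^2}$ is antisymmetric, i.e. $\hat\delta(j,k)=-\hat\delta(k,j)$ for all $j,k\in J$, then this same $e$ is an $\tilde e$-broom for $J$ by $(t_r(j))_{j\in J}$. Consequently, in bounded-syncausal-path contexts, for finite $I$: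 * (Broom) if $P$ solves $\mathrm{ER}\langle\tilde e,I\rangle$ and in each triggered run all agents of $I$ respond at the same time, then every $\tilde e$-triggered run $r$ contains an $\tilde e$-broom for $I$ by that common time; * (Uneven Broom) if $P$ solves $\mathrm{ER}\langle\tilde e,I\rangle$ and, for given $(T_i)_{i\in I}\in\mathbb T^I$, $t_r(i)-t_r(j)=T_i-T_j$ for all $i,j\in I$ and every triggered run $r$, then every $\tilde e$-triggered run $r$ contains an $\tilde e$-broom for $I$ by $(t_r(i))_{i\in I}$. -/

import Mathlib

open scoped NNReal ENNReal

noncomputable section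

set_option linter.checkUnivs false

namespace TimelyResponse

universe u v w x

/-! ## Networks, events and environment histories

Time is continuous: the set of times is `ℝ≥0`. -/

/-- The communication network: a directed graph of agents whose channels carry positive, possibly
infinite, delivery bounds; the possible message contents; and the possible external inputs, each
with the agent that observes it. -/
structure Network where
  Agent : Type u
  Msg : Type v
  Input : Type w
  /-- `link i j`: agent `i` may send messages to agent `j` -/
  link : Agent → Agent → Prop
  /-- the maximum delivery time along a channel -/
  bound : Agent → Agent → ℝ≥0∞
  bound_pos : ∀ i j, link i j → 0 < bound i j
  /-- the agent observing a given external input -/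
  observer : Input → Agent

/-- A sent message: its content, its sending time, and the channel it was sent along. -/
structure Packet (N : Network.{u, v, w}) where
  content : N.Msg
  sentAt : ℝ≥0
  src : N.Agent
  dst : N.Agent
  isLink : N.link src dst

/-- State of the environment at a given time: the external inputs that occur, the messages that
are delivered, and the agents whose timers ring. -/
structure EnvState (N : Network.{u, v, w}) where
  inputs : Set N.Input
  deliveries : Set (Packet N)
  rings : Set N.Agent

/-- A history of the environment. -/
abbrev Env (N : Network.{u, v, w}) := ℝ≥0 → EnvState N

inductive Event (N : Network.{u, v, w}) where
  | input (e : N.Input) : Event N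
  | delivery (p : Packet N) : Event N
  | ring (i : N.Agent) : Event N

variable {N : Network.{u, v, w}}

/-- The agent that observes an event. -/
def Event.agent : Event N → N.Agent
  | .input e => N.observer e
  | .delivery p => p.dst
  | .ring i => i

/-- An event paired with its occurrence time. -/
abbrev TimedEvent (N : Network.{u, v, w}) := Event N × ℝ≥0

/-- The agent-time pair at which a timed event is observed. -/
def TimedEvent.node (e : TimedEvent N) : N.Agent × ℝ≥0 := (e.1.agent, e.2)

/-- The delivery of `p` at `t` is early: it precedes the guaranteed delivery time. -/
def Packet.EarlyAt (p : Packet N) (t : ℝ≥0) : Prop :=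
  (t : ℝ≥0∞) < (p.sentAt : ℝ≥0∞) + N.bound p.src p.dst

/-- The timed event takes place in the given history. -/
def Occurs (E : Env N) : TimedEvent N → Prop
  | (.input e, t) => e ∈ (E t).inputs
  | (.delivery p, t) => p ∈ (E t).deliveries
  | (.ring i, t) => i ∈ (E t).rings

/-- Non-deterministic kinds of events: external inputs and early deliveries. -/
def IsND : TimedEvent N → Prop
  | (.input _, _) => True
  | (.delivery p, t) => p.EarlyAt t
  | (.ring _, _) => False

/-- The set of non-deterministic (ND) events of a history. -/
def ND (E : Env N) : Set (TimedEvent N) := {e | Occurs E e ∧ IsND e}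

/-- The ND events that occur no later than `t`. -/
def NDUpTo (E : Env N) (t : ℝ≥0) : Set (TimedEvent N) := {e | e ∈ ND E ∧ e.2 ≤ t}

/-- Agent `i` observes some event at time `t`. -/
def Observes (E : Env N) (i : N.Agent) (t : ℝ≥0) : Prop :=
  ∃ e : Event N, e.agent = i ∧ Occurs E (e, t)

/-- Agent `i` is enabled (to act) at `t`: either `t = 0`, or `t` is a supremum of a set of times
at each of which `i` observes an event. -/
def Enabled (E : Env N) (i : N.Agent) (t : ℝ≥0) : Prop :=
  t = 0 ∨ ∃ A : Set ℝ≥0, (∀ s ∈ A, Observes E i s) ∧ IsLUB A t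

/-! ## Syncausality and bound guarantee -/

/-- `SyncPath E n θ θ'`: there is a syncausal path from `θ` to `θ'`, i.e. a finite sequence of
locality, message delivery and delivery guarantee steps, along which exactly `n` of the messages
are delivered early (so that the path goes through `n` ND events after its starting node). -/
inductive SyncPath (E : Env N) : ℕ → N.Agent × ℝ≥0 → N.Agent × ℝ≥0 → Prop
  | refl (θ : N.Agent × ℝ≥0) : SyncPath E 0 θ θ
  | locality {n : ℕ} {θ : N.Agent × ℝ≥0} {i : N.Agent} {t t' : ℝ≥0} :
      SyncPath E n θ (i, t) → t ≤ t' → SyncPath E n θ (i, t')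
  | guarantee {n : ℕ} {θ : N.Agent × ℝ≥0} {i j : N.Agent} {t β : ℝ≥0} :
      SyncPath E n θ (i, t) → N.link i j → N.bound i j = (β : ℝ≥0∞) →
        SyncPath E n θ (j, t + β)
  | early {n : ℕ} {θ : N.Agent × ℝ≥0} {p : Packet N} {t : ℝ≥0} :
      SyncPath E n θ (p.src, p.sentAt) → p ∈ (E t).deliveries → p.EarlyAt t →
        SyncPath E (n + 1) θ (p.dst, t)
  | onTime {n : ℕ} {θ : N.Agent × ℝ≥0} {p : Packet N} {t : ℝ≥0} :
      SyncPath E n θ (p.src, p.sentAt) → p ∈ (E t).deliveries → ¬ p.EarlyAt t →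
        SyncPath E n θ (p.dst, t)

/-- Syncausality: the transitive closure of locality, message delivery, delivery guarantee. -/
def Sync (E : Env N) (θ θ' : N.Agent × ℝ≥0) : Prop := ∃ n, SyncPath E n θ θ'

/-- Bound guarantee: the transitive closure of locality and delivery guarantee. -/
inductive Guar : N.Agent × ℝ≥0 → N.Agent × ℝ≥0 → Prop
  | refl (θ : N.Agent × ℝ≥0) : Guar θ θ
  | locality {θ : N.Agent × ℝ≥0} {i : N.Agent} {t t' : ℝ≥0} :
      Guar θ (i, t) → t ≤ t' → Guar θ (i, t')
  | guarantee {θ : N.Agent × ℝ≥0} {i j : N.Agent} {t β : ℝ≥0} :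
      Guar θ (i, t) → N.link i j → N.bound i j = (β : ℝ≥0∞) → Guar θ (j, t + β)

/-- Syncausality between events: `e = e'`, or `e'` is the delivery of a message whose sending
is in the syncausal future of `e`. -/
def EventSync (E : Env N) (e e' : TimedEvent N) : Prop :=
  e = e' ∨ ∃ p : Packet N, e'.1 = .delivery p ∧ Sync E e.node (p.src, p.sentAt)

/-- The ND past of an agent-time pair. -/
def PND (E : Env N) (θ : N.Agent × ℝ≥0) : Set (TimedEvent N) :=
  {e | e ∈ ND E ∧ Sync E e.node θ}

open Classical in
/-- The supremum of the number of ND events traversed by a syncausal path from `θ` to `θ'`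
(after its starting node); infinite if there is no such path. -/
def pathCount (E : Env N) (θ θ' : N.Agent × ℝ≥0) : ℕ∞ :=
  if Sync E θ θ' then ⨆ n : {n : ℕ // SyncPath E n θ θ'}, ((n : ℕ) : ℕ∞) else ⊤

/-- The supremum of the number of ND events in a syncausal path from the ND event `e` to `θ`;
the event `e`, from which such a path starts, is one of them. -/
def pathCountFrom (E : Env N) (e : TimedEvent N) (θ : N.Agent × ℝ≥0) : ℕ∞ :=
  1 + pathCount E e.node θ

/-- `e` is an `inp`-broom for the family of agents `(a j)`, `j ∈ J`, by the times `(τ j)`. -/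
def IsBroom {ι : Type*} (E : Env N) (inp : N.Input) (a : ι → N.Agent) (J : Set ι) (τ : ι → ℝ≥0)
    (e : TimedEvent N) : Prop :=
  e ∈ ND E ∧ (∃ s, inp ∈ (E s).inputs ∧ EventSync E (.input inp, s) e) ∧
    ∀ j ∈ J, Guar e.node (a j, τ j)

/-- No infinite causal regress: there is no infinite sequence of enabled agent-time pairs that
goes strictly back in time along syncausality. -/
def NoRegress (E : Env N) : Prop :=
  ¬ ∃ f : ℕ → N.Agent × ℝ≥0, ∀ n, Enabled E (f n).1 (f n).2 ∧
      (f (n + 1)).2 < (f n).2 ∧ Sync E (f (n + 1)) (f n)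

/-! ## Contexts, protocols and runs -/

/-- A context: a network, a set of legal states for each agent together with a pseudo-limit
function (giving the state "just before" a time), and the constraints on the environment. -/
structure Context extends Network.{u, v, w} where
  State : Agent → Type x
  lim : ∀ i, (Set.Ioo (-1 : ℝ) 0 → State i) → State i
  lim_congr : ∀ i (f g : Set.Ioo (-1 : ℝ) 0 → State i) (ε : ℝ), 0 < ε →
    (∀ y : Set.Ioo (-1 : ℝ) 0, -ε < (y : ℝ) → f y = g y) → lim i f = lim i g
  lim_const : ∀ i (s : State i), lim i (fun _ => s) = s
  /-- the histories permitted by the environment constraints that are part of the model, such as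
  a minimal delivery time or integrality of event times (`Set.univ` if there are none) -/
  admissible : Set (Env toNetwork)

variable {γ : Context.{u, v, w, x}}

/-- What an enabled agent may do: set a new state, send messages to neighbours, possibly set a
timer, possibly respond. -/
structure Action (γ : Context.{u, v, w, x}) (i : γ.Agent) where
  newState : γ.State i
  messages : Set (γ.Msg × {j : γ.Agent // γ.link i j})
  timer : Option ℝ≥0
  responds : Bool

/-- The events an agent observes at a given time: external inputs, message contents paired with
their senders, and whether its timer rings. -/
structure Observation (γ : Context.{u, v, w, x}) (i : γ.Agent) where
  inputs : Set {e : γ.Input // γ.observer e = i}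
  received : Set (γ.Msg × γ.Agent)
  ring : Prop

/-- A (deterministic) joint protocol: for each agent, a set of initial states and an action
function. Actions may depend on the current time; protocols of a model without a shared clock are
those that ignore this argument. -/
structure Protocol (γ : Context.{u, v, w, x}) where
  startStates : ∀ i, Set (γ.State i)
  act : ∀ i, γ.State i → Observation γ i → ℝ≥0 → Action γ i

/-- The data of a run: the initial state each agent uses, the environment, the agent states. -/
structure Run (γ : Context.{u, v, w, x}) where
  start : ∀ i, γ.State i
  env : Env γ.toNetwork
  state : ∀ i, ℝ≥0 → γ.State i

namespace Run

/-- The state of `i` just before `t` (at `t = 0`: its initial state). -/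
def preState (r : Run γ) (i : γ.Agent) (t : ℝ≥0) : γ.State i :=
  if t = 0 then r.start i else γ.lim i fun y => r.state i (Real.toNNReal ((t : ℝ) + y))

/-- What `i` observes at `t`. -/
def obs (r : Run γ) (i : γ.Agent) (t : ℝ≥0) : Observation γ i where
  inputs := {e | e.1 ∈ (r.env t).inputs}
  received := {q | ∃ p ∈ (r.env t).deliveries, p.dst = i ∧ p.content = q.1 ∧ p.src = q.2}
  ring := i ∈ (r.env t).rings

/-- The output of the protocol for `i` at `t`; it takes effect only if `i` is enabled at `t`. -/
def action (P : Protocol γ) (r : Run γ) (i : γ.Agent) (t : ℝ≥0) : Action γ i :=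
  P.act i (r.preState i t) (r.obs i t) t

/-- The message `p` is sent in `r`, by its source and at its sending time. -/
def Sent (P : Protocol γ) (r : Run γ) (p : Packet γ.toNetwork) : Prop :=
  Enabled r.env p.src p.sentAt ∧
    (p.content, ⟨p.dst, p.isLink⟩) ∈ (r.action P p.src p.sentAt).messages

/-- Agent `i` responds at `t`. -/
def Responds (P : Protocol γ) (r : Run γ) (i : γ.Agent) (t : ℝ≥0) : Prop :=
  Enabled r.env i t ∧ (r.action P i t).responds = true

/-- At `t'`, agent `i` sets a timer for `t`. -/
def SetsTimer (P : Protocol γ) (r : Run γ) (i : γ.Agent) (t' t : ℝ≥0) : Prop :=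
  Enabled r.env i t' ∧ (r.action P i t').timer = some t

end Run

/-- `r` is a run of the protocol `P`. -/
structure IsRun (P : Protocol γ) (r : Run γ) : Prop where
  start_mem : ∀ i, r.start i ∈ P.startStates i
  state_enabled : ∀ i t, Enabled r.env i t → r.state i t = (r.action P i t).newState
  state_idle : ∀ i t, ¬ Enabled r.env i t → r.state i t = r.preState i t
  /-- an agent keeps its state as long as it is not enabled -/
  state_keep : ∀ i t t', t ≤ t' → (∀ s, t < s → s ≤ t' → ¬ Enabled r.env i s) →
    r.state i t' = r.state i t
  /-- every external input occurs at most once -/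
  input_once : ∀ e t t', e ∈ (r.env t).inputs → e ∈ (r.env t').inputs → t = t'
  /-- every message sent is delivered exactly once -/
  delivered : ∀ p, r.Sent P p → ∃! t, p ∈ (r.env t).deliveries
  /-- only messages that are sent are delivered, after they are sent and within the bound -/
  delivery : ∀ p t, p ∈ (r.env t).deliveries → r.Sent P p ∧ p.sentAt < t ∧
    (t : ℝ≥0∞) ≤ (p.sentAt : ℝ≥0∞) + γ.bound p.src p.dst
  timer : ∀ i t, i ∈ (r.env t).rings ↔
    ∃ t', t' < t ∧ r.SetsTimer P i t' t ∧ ∀ s, t' < s → s < t → ¬ Enabled r.env i s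
  noRegress : NoRegress r.env
  admissible : r.env ∈ γ.admissible

/-- The set of runs of `P`. -/
def runs (P : Protocol γ) : Set (Run γ) := {r | IsRun P r}

/-- The set of `inp`-triggered runs of `P`. -/
def triggeredRuns (P : Protocol γ) (inp : γ.Input) : Set (Run γ) :=
  {r | r ∈ runs P ∧ ∃ s, inp ∈ (r.env s).inputs}

/-- `r'` is a `t`-subrun of `r`. -/
def Subrun (t : ℝ≥0) (r' r : Run γ) : Prop :=
  r'.start = r.start ∧ NDUpTo r'.env t ⊆ NDUpTo r.env t

/-- The `t`-retainable subsets of the ND events of `r`. -/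
def RND (P : Protocol γ) (r : Run γ) (t : ℝ≥0) : Set (Set (TimedEvent γ.toNetwork)) :=
  {F | ∃ r' ∈ runs P, Subrun t r' r ∧ NDUpTo r'.env t = F}

/-- `r'` and `r` coincide up to and including time `t`. -/
def AgreeUpTo (t : ℝ≥0) (r' r : Run γ) : Prop :=
  r'.start = r.start ∧ ∀ s ≤ t, r'.env s = r.env s ∧ ∀ i, r'.state i s = r.state i s

/-- Any run may be continued after any time without external inputs and with every early delivery
taking at least `d` time units. -/
def NoForesight (P : Protocol γ) : Prop :=
  ∀ r ∈ runs P, ∀ t d : ℝ≥0, ∃ r' ∈ runs P, AgreeUpTo t r' r ∧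
    (∀ s, t < s → (r'.env s).inputs = ∅) ∧
    ∀ s, t < s → ∀ p ∈ (r'.env s).deliveries, p.EarlyAt s → p.sentAt + d ≤ s

/-- The ND past of `(i, t)` is `t`-retainable. -/
def NoExtrasensoryPerception (P : Protocol γ) : Prop :=
  ∀ r ∈ runs P, ∀ (t : ℝ≥0) (i : γ.Agent), PND r.env (i, t) ∈ RND P r t

/-- Syncausal paths between two given agent-time pairs have boundedly many ND events, in every run
of every protocol. -/
def BoundedSyncausalPath (γ : Context.{u, v, w, x}) : Prop :=
  ∀ (P : Protocol γ), ∀ r ∈ runs P, ∀ θ θ' : γ.Agent × ℝ≥0,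
    Sync r.env θ θ' → pathCount r.env θ θ' < ⊤

/-! ## Constraining functions and response problems -/

/-- Constraining functions on ordered pairs of distinct elements of `ι`. -/
abbrev Spec (ι : Type*) := ∀ i j : ι, i ≠ j → EReal

/-- `T` is an implementation of `δ`. -/
def Implements {ι : Type*} (δ : Spec ι) (T : ι → ℝ≥0) : Prop :=
  ∀ i j (h : i ≠ j), ((T j : ℝ) : EReal) ≤ ((T i : ℝ) : EReal) + δ i j h

/-- `PathLen δ i j ℓ`: the directed graph `G_δ`, whose edges are the pairs of distinct elements
on which `δ` is not `∞`, has a path from `i` to `j` of length `ℓ`. -/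
inductive PathLen {ι : Type*} (δ : Spec ι) : ι → ι → EReal → Prop
  | single (i : ι) : PathLen δ i i 0
  | cons {i j k : ι} {ℓ : EReal} (h : i ≠ j) :
      δ i j h ≠ ⊤ → PathLen δ j k ℓ → PathLen δ i k (δ i j h + ℓ)

/-- The canonical form of `δ`: the distance function of `G_δ`. -/
def canon {ι : Type*} (δ : Spec ι) (i j : ι) : EReal := sInf {ℓ | PathLen δ i j ℓ}

/-- `J` is contained in one strongly connected component of `G_δ`. -/
def InOneComponent {ι : Type*} (δ : Spec ι) (J : Set ι) : Prop :=
  ∀ i ∈ J, ∀ j ∈ J, ∃ ℓ, PathLen δ i j ℓ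

/-- The time at which `i` responds in `r` (meaningful when `i` responds exactly once). -/
def responseTime (P : Protocol γ) (r : Run γ) (i : γ.Agent) : ℝ≥0 := sInf {t | r.Responds P i t}

/-- Eventual response: in triggered runs each agent in `I` responds exactly once; in all other
runs no agent in `I` responds. -/
def ER (inp : γ.Input) (I : Set γ.Agent) : Set (Protocol γ) :=
  {P | (∀ r ∈ triggeredRuns P inp, ∀ i ∈ I, ∃! t, r.Responds P i t) ∧
    ∀ r ∈ runs P, r ∉ triggeredRuns P inp → ∀ i ∈ I, ∀ t, ¬ r.Responds P i t}

/-- Timely-coordinated response. -/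
def TCR (inp : γ.Input) (I : Set γ.Agent) (δ : Spec I) : Set (Protocol γ) :=
  {P | P ∈ ER inp I ∧
    ∀ r ∈ triggeredRuns P inp, Implements δ fun i : I => responseTime P r i}

/-- Simultaneous response. -/
def SR (inp : γ.Input) (I : Set γ.Agent) : Set (Protocol γ) :=
  {P | P ∈ ER inp I ∧
    ∀ r ∈ triggeredRuns P inp, ∀ i ∈ I, ∀ j ∈ I, responseTime P r i = responseTime P r j}

/-- Tightly-timed response with prescribed time differences `T i - T j`. -/
def TTR (inp : γ.Input) (I : Set γ.Agent) (T : I → ℝ≥0) : Set (Protocol γ) :=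
  {P | P ∈ ER inp I ∧ ∀ r ∈ triggeredRuns P inp, ∀ i j : I,
    (responseTime P r i : ℝ) - responseTime P r j = (T i : ℝ) - T j}

end TimelyResponse

end

namespace TimelyResponse

universe u v w x

/-! ### Syncausal paths and enabled times in a single history -/

section Histories

variable {N : Network.{u, v, w}} {E E' : Env N}

/-! An agent's behaviour at `(i, t)` is determined by the initial states and the ND past of `(i, t)`
(`IsRun.agreeAt`). So when `i` responds at `t` in a triggered run, all ND events outside its ND past
can be deleted and the future made quiet: no inputs, and early deliveries as late as desired. The
agent `i` still responds at `t`, so the new run is triggered and all other agents must respond in it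
too, with essentially nothing to rely on but what `i` already had in its past
(`exists_continuation`).

If response times in `J` differ by at most `D`, the next agent responds in the new run by `t + D`,
and its ND past there lies inside that of `i` in the old run. Iterating along a sequence of agents
`σ 0 = i, σ 1, …` gives a chain of ND events `… ⇝ e 1 ⇝ e 0`, all between the trigger and the
response of `i`, where `e k` guarantees `σ k` by time `t + k * D` (`exists_centipede`).

Let `σ` run cyclically through `J`, and put `m = |J| - 1`. Each strict step of the chain costs one
ND event on a syncausal path from the trigger to `(i, t)`, and such a path has at most `L` of them,
trigger included. Among the `L` blocks of `m` steps, one is therefore constant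
(`exists_constant_block`). Its `m + 1` agents exhaust `J`, so the single event of that block is a
broom, with horizon at most `t + L * m * D`. If the differences between response times are the same
in all triggered runs, the auxiliary runs have the response times of the original one, and the broom
meets these exactly.

For a constraining function, `D` is the maximum of its canonical form on `J`. The two broom theorems
are the case of prescribed differences, where the canonical form is antisymmetric. -/

theorem SyncPath.trans {m n : ℕ} {a b c : N.Agent × ℝ≥0} (h : SyncPath E m a b)
    (h' : SyncPath E n b c) : SyncPath E (m + n) a c := by
  induction h' with
  | refl => exact h
  | locality _ ht ih => exact (ih h).locality ht
  | guarantee _ hl hb ih => exact (ih h).guarantee hl hb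
  | early _ hd he ih => exact (ih h).early hd he
  | onTime _ hd he ih => exact (ih h).onTime hd he

theorem Sync.trans {a b c : N.Agent × ℝ≥0} (h : Sync E a b) (h' : Sync E b c) : Sync E a c :=
  let ⟨_, hm⟩ := h
  let ⟨_, hn⟩ := h'
  ⟨_, hm.trans hn⟩

theorem Sync.of_le {i : N.Agent} {t t' : ℝ≥0} (h : t ≤ t') : Sync E (i, t) (i, t') :=
  ⟨0, (SyncPath.refl _).locality h⟩

theorem Guar.syncPath {a b : N.Agent × ℝ≥0} (h : Guar a b) : SyncPath E 0 a b := by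
  induction h with
  | refl => exact .refl _
  | locality _ ht ih => exact ih.locality ht
  | guarantee _ hl hb ih => exact ih.guarantee hl hb

/-- Messages are delivered after they are sent, and within the delivery bound. -/
def RespectsBounds (E : Env N) : Prop :=
  ∀ p t, p ∈ (E t).deliveries → p.sentAt < t ∧
    (t : ℝ≥0∞) ≤ (p.sentAt : ℝ≥0∞) + N.bound p.src p.dst

theorem SyncPath.time_le (hE : RespectsBounds E) {n : ℕ} {a b : N.Agent × ℝ≥0}
    (h : SyncPath E n a b) : a.2 ≤ b.2 := by
  induction h with
  | refl => exact le_rfl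
  | locality _ ht ih => exact ih.trans ht
  | guarantee _ _ _ ih => exact ih.trans le_self_add
  | early _ hd _ ih => exact ih.trans (hE _ _ hd).1.le
  | onTime _ hd _ ih => exact ih.trans (hE _ _ hd).1.le

/-- A delivery that is not early happens exactly at the end of a finite bound, so it can be replaced
by a guarantee step, which makes no reference to any message. -/
theorem RespectsBounds.bound_eq (hE : RespectsBounds E) {p : Packet N} {t : ℝ≥0}
    (hp : p ∈ (E t).deliveries) (hnear : ¬ p.EarlyAt t) :
    ∃ β : ℝ≥0, N.bound p.src p.dst = β ∧ p.sentAt + β = t := by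
  have h := le_antisymm (not_lt.1 hnear) (hE p t hp).2
  have hne : N.bound p.src p.dst ≠ ⊤ := by
    intro htop
    rw [htop] at h
    simp at h
  lift N.bound p.src p.dst to ℝ≥0 using hne with β
  exact ⟨β, rfl, by exact_mod_cast h⟩

/-- A syncausal path from an ND event ends with a bound guarantee from its last ND event. -/
theorem SyncPath.exists_last_ND (hE : RespectsBounds E) {n : ℕ} {e : TimedEvent N}
    {θ : N.Agent × ℝ≥0} (he : e ∈ ND E) (h : SyncPath E n e.node θ) :
    ∃ e' ∈ ND E, EventSync E e e' ∧ Guar e'.node θ := by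
  generalize ha : e.node = a at h
  induction h with
  | refl => exact ⟨e, he, .inl rfl, ha ▸ .refl _⟩
  | locality _ ht ih =>
    obtain ⟨e', h1, h2, h3⟩ := ih ha
    exact ⟨e', h1, h2, h3.locality ht⟩
  | guarantee _ hl hb ih =>
    obtain ⟨e', h1, h2, h3⟩ := ih ha
    exact ⟨e', h1, h2, h3.guarantee hl hb⟩
  | @early n θ p t hs hd hp ih =>
    -- An early delivery is itself ND, so it supersedes the previous candidate.
    exact ⟨(.delivery p, t), ⟨hd, hp⟩, .inr ⟨p, rfl, ha ▸ ⟨_, hs⟩⟩, .refl _⟩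
  | @onTime n θ p t hs hd hp ih =>
    obtain ⟨e', h1, h2, h3⟩ := ih ha
    obtain ⟨β, hb, rfl⟩ := hE.bound_eq hd hp
    exact ⟨e', h1, h2, h3.guarantee p.isLink hb⟩

/-- Syncausal paths inside the past of `θ` only depend on the ND past of `θ`. -/
theorem SyncPath.transfer (hE : RespectsBounds E) {θ : N.Agent × ℝ≥0} (hθ : PND E θ ⊆ ND E')
    {n : ℕ} {a b : N.Agent × ℝ≥0} (h : SyncPath E n a b) (hb : Sync E b θ) :
    SyncPath E' n a b := by
  induction h with
  | refl => exact .refl _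
  | locality _ ht ih => exact (ih ((Sync.of_le ht).trans hb)).locality ht
  | guarantee _ hl hβ ih =>
    exact (ih (Sync.trans ⟨0, (SyncPath.refl _).guarantee hl hβ⟩ hb)).guarantee hl hβ
  | @early n c p t hs hd hp ih =>
    have hmem : ((.delivery p, t) : TimedEvent N) ∈ ND E' := hθ ⟨⟨hd, hp⟩, hb⟩
    exact (ih (Sync.trans ⟨1, (SyncPath.refl _).early hd hp⟩ hb)).early hmem.1 hp
  | @onTime n c p t hs hd hp ih =>
    -- The message need not exist in `E'`; the guarantee step along its channel does.
    obtain ⟨β, hβ, rfl⟩ := hE.bound_eq hd hp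
    exact (ih (Sync.trans ⟨0, (SyncPath.refl _).guarantee p.isLink hβ⟩ hb)).guarantee p.isLink hβ

theorem Sync.transfer (hE : RespectsBounds E) {θ : N.Agent × ℝ≥0} (hθ : PND E θ ⊆ ND E')
    {a b : N.Agent × ℝ≥0} (h : Sync E a b) (hb : Sync E b θ) : Sync E' a b :=
  let ⟨n, hn⟩ := h
  ⟨n, hn.transfer hE hθ hb⟩

theorem EventSync.transfer (hE : RespectsBounds E) {θ : N.Agent × ℝ≥0} (hθ : PND E θ ⊆ ND E')
    {e e' : TimedEvent N} (h : EventSync E e e') (he' : e' ∈ PND E θ) : EventSync E' e e' := by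
  obtain rfl | ⟨p, hp, hs⟩ := h
  · exact .inl rfl
  · obtain ⟨e', t⟩ := e'
    obtain rfl : e' = .delivery p := hp
    exact .inr ⟨p, rfl, hs.transfer hE hθ
      (Sync.trans ⟨1, (SyncPath.refl _).early he'.1.1 he'.1.2⟩ he'.2)⟩

/-- The later event is a delivery and ND, hence early, so a step between distinct events adds at
least one to the count. -/
theorem EventSync.exists_syncPath {e e' : TimedEvent N} (h : EventSync E e e') (hne : e ≠ e')
    (he' : e' ∈ ND E) : ∃ n, SyncPath E (n + 1) e.node e'.node := by
  obtain rfl | ⟨p, hp, n, hs⟩ := h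
  · exact absurd rfl hne
  · obtain ⟨e', t⟩ := e'
    obtain rfl : e' = .delivery p := hp
    exact ⟨n, hs.early he'.1 he'.2⟩

theorem EventSync.sync {e e' : TimedEvent N} (h : EventSync E e e') (he' : e' ∈ ND E) :
    Sync E e.node e'.node := by
  by_cases hne : e = e'
  · subst hne
    exact ⟨0, .refl _⟩
  · obtain ⟨n, hn⟩ := h.exists_syncPath hne he'
    exact ⟨_, hn⟩

theorem Observes.enabled {i : N.Agent} {t : ℝ≥0} (h : Observes E i t) : Enabled E i t :=
  .inr ⟨{t}, by simpa using h, isLUB_singleton⟩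

theorem Enabled.congr {i : N.Agent} {t : ℝ≥0}
    (h : ∀ s ≤ t, Observes E i s ↔ Observes E' i s) : Enabled E i t ↔ Enabled E' i t :=
  or_congr_right ⟨fun ⟨A, hA, hl⟩ => ⟨A, fun s hs => (h s (hl.1 hs)).1 (hA s hs), hl⟩,
    fun ⟨A, hA, hl⟩ => ⟨A, fun s hs => (h s (hl.1 hs)).2 (hA s hs), hl⟩⟩

/-- There is a last time up to `t` at which `i` is enabled. -/
theorem exists_last_enabled (E : Env N) (i : N.Agent) (t : ℝ≥0) :
    ∃ s ≤ t, Enabled E i s ∧ ∀ s', s < s' → s' ≤ t → ¬ Enabled E i s' := by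
  set B : Set ℝ≥0 := {s | s ≤ t ∧ Enabled E i s}
  have hB : IsLUB B (sSup B) :=
    isLUB_csSup ⟨0, zero_le, .inl rfl⟩ ⟨t, fun _ hs => hs.1⟩
  -- Suprema of suprema are suprema: the last enabled time is the supremum of all observation times
  -- up to it. Time `0` keeps `B` nonempty.
  refine ⟨sSup B, hB.2 fun _ hs => hs.1, .inr ⟨{a | a ≤ sSup B ∧ Observes E i a},
    fun s hs => hs.2, fun _ hs => hs.1, fun c hc => hB.2 fun b hb => ?_⟩,
    fun s' h1 h2 h3 => h1.not_ge (hB.1 ⟨h2, h3⟩)⟩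
  obtain h0 | ⟨A, hA, hl⟩ := hb.2
  · exact h0 ▸ zero_le
  · exact hl.2 fun a ha => hc ⟨(hl.1 ha).trans (hB.1 hb), hA a ha⟩

/-- Descent form of the regress axiom, by dependent choice. It replaces induction on time, which is
not well-founded in the continuum. -/
theorem NoRegress.eq_empty (h : NoRegress E) {B : Set (N.Agent × ℝ≥0)}
    (hB : ∀ θ ∈ B, Enabled E θ.1 θ.2 ∧ ∃ θ' ∈ B, θ'.2 < θ.2 ∧ Sync E θ' θ) : B = ∅ := by
  by_contra hne
  obtain ⟨θ₀, h₀⟩ := Set.nonempty_iff_ne_empty.2 hne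
  choose! f hf using fun θ hθ => (hB θ hθ).2
  have hmem : ∀ n, f^[n] θ₀ ∈ B := fun n => by
    induction n with
    | zero => exact h₀
    | succ n ih => rw [Function.iterate_succ_apply']; exact (hf _ ih).1
  refine h ⟨fun n => f^[n] θ₀, fun n => ⟨(hB _ (hmem n)).1, ?_⟩⟩
  simp only [Function.iterate_succ_apply']
  exact (hf _ (hmem n)).2

end Histories

/-! ### Behaviour is determined by initial states and ND past -/

section Determinism

variable {γ : Context.{u, v, w, x}} {P : Protocol γ} {r r' : Run γ}

theorem IsRun.respectsBounds (h : IsRun P r) : RespectsBounds r.env :=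
  fun p t hp => (h.delivery p t hp).2

theorem Run.obs_congr {i : γ.Agent} {t : ℝ≥0}
    (h : ∀ e : Event γ.toNetwork, e.agent = i → (Occurs r.env (e, t) ↔ Occurs r'.env (e, t))) :
    r.obs i t = r'.obs i t := by
  have hd : ∀ p : Packet γ.toNetwork, p.dst = i →
      (p ∈ (r.env t).deliveries ↔ p ∈ (r'.env t).deliveries) := fun p hp => h (.delivery p) hp
  have hr : i ∈ (r.env t).rings ↔ i ∈ (r'.env t).rings := h (.ring i) rfl
  unfold Run.obs
  congr 1
  · ext e
    exact h (.input e.1) e.2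
  · ext q
    exact ⟨fun ⟨p, h1, h2, h3⟩ => ⟨p, (hd p h2).1 h1, h2, h3⟩,
      fun ⟨p, h1, h2, h3⟩ => ⟨p, (hd p h2).2 h1, h2, h3⟩⟩
  · exact propext hr

theorem Run.preState_congr {i : γ.Agent} {t : ℝ≥0} (h0 : r.start = r'.start)
    (h : ∀ s < t, r.state i s = r'.state i s) : r.preState i t = r'.preState i t := by
  unfold Run.preState
  split_ifs with ht
  · rw [h0]
  · have htpos : (0 : ℝ) < t := by exact_mod_cast pos_iff_ne_zero.2 ht
    -- Taking the germ on `(-t, 0)` keeps `t + y` positive, so `Real.toNNReal` does not truncate.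
    refine γ.lim_congr i _ _ t htpos fun y hy => h _ ?_
    rw [← NNReal.coe_lt_coe, Real.coe_toNNReal _ (by linarith)]
    linarith [y.2.2]

/-- The two runs behave in the same way at an agent-time pair. -/
structure AgreeAt (P : Protocol γ) (r r' : Run γ) (θ : γ.Agent × ℝ≥0) : Prop where
  enabled : Enabled r.env θ.1 θ.2 ↔ Enabled r'.env θ.1 θ.2
  action : r.action P θ.1 θ.2 = r'.action P θ.1 θ.2
  state : r.state θ.1 θ.2 = r'.state θ.1 θ.2
  occurs : ∀ e : Event γ.toNetwork, e.agent = θ.1 →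
    (Occurs r.env (e, θ.2) ↔ Occurs r'.env (e, θ.2))

theorem AgreeAt.responds {i : γ.Agent} {t : ℝ≥0} (h : AgreeAt P r r' (i, t)) :
    r.Responds P i t ↔ r'.Responds P i t := by
  have h1 := h.enabled
  have h2 := h.action
  dsimp only at h1 h2
  rw [Run.Responds, Run.Responds, h1, h2]

theorem AgreeAt.sent {p : Packet γ.toNetwork} (h : AgreeAt P r r' (p.src, p.sentAt)) :
    r.Sent P p ↔ r'.Sent P p := by
  have h1 := h.enabled
  have h2 := h.action
  dsimp only at h1 h2
  rw [Run.Sent, Run.Sent, h1, h2]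

theorem AgreeAt.setsTimer {i : γ.Agent} {t t' : ℝ≥0} (h : AgreeAt P r r' (i, t')) :
    r.SetsTimer P i t' t ↔ r'.SetsTimer P i t' t := by
  have h1 := h.enabled
  have h2 := h.action
  dsimp only at h1 h2
  rw [Run.SetsTimer, Run.SetsTimer, h1, h2]

/-- Agreement is needed only where some run is enabled: both runs have the same last enabled time
and keep their state from then on. -/
theorem IsRun.state_eq_of_forall (hr : IsRun P r) (hr' : IsRun P r') {j : γ.Agent} {s : ℝ≥0}
    (ih : ∀ s' ≤ s, Enabled r.env j s' ∨ Enabled r'.env j s' → AgreeAt P r r' (j, s')) :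
    r.state j s = r'.state j s := by
  obtain ⟨c, hc, hen, hlast⟩ := exists_last_enabled r.env j s
  rw [hr.state_keep j c s hc hlast, hr'.state_keep j c s hc fun s' h1 h2 h3 =>
    hlast s' h1 h2 ((ih s' h2 (.inr h3)).enabled.2 h3)]
  exact (ih c hc (.inl hen)).state

/-- On-time deliveries are determined by the messages sent and by the early deliveries. -/
theorem IsRun.delivered_of_delivered (hr : IsRun P r) (hr' : IsRun P r') {p : Packet γ.toNetwork}
    {s : ℝ≥0} (hp : p ∈ (r.env s).deliveries) (hnear : ¬ p.EarlyAt s)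
    (hsent : r.Sent P p → r'.Sent P p)
    (hearly : ∀ s' < s, p ∈ (r'.env s').deliveries → p.EarlyAt s' →
      p ∈ (r.env s').deliveries) :
    p ∈ (r'.env s).deliveries := by
  have hs := (hr.delivery p s hp).1
  obtain ⟨s', hs', -⟩ := hr'.delivered p (hsent hs)
  have hle : (s' : ℝ≥0∞) ≤ s := (hr'.delivery p s' hs').2.2.trans (not_lt.1 hnear)
  obtain hlt | rfl := (show s' ≤ s by exact_mod_cast hle).lt_or_eq
  -- Delivery in `r'` before `s` would be early, hence also occur in `r`, where `p` would be
  -- delivered twice.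
  · have he : p.EarlyAt s' := lt_of_lt_of_le (by exact_mod_cast hlt) (hr.delivery p s hp).2.2
    exact absurd ((hr.delivered p hs).unique (hearly s' hlt hs' he) hp) hlt.ne
  · exact hs'

/-- Inductive step of determinism. What `j` observes at `s` is either ND, hence prescribed by `hND`;
or an on-time delivery, decided by a sending one guarantee step back; or a timer ring, decided by
earlier actions of `j` itself. Observations and the state just before `s` then fix the action. -/
theorem IsRun.agreeAt_of_forall (hr : IsRun P r) (hr' : IsRun P r') (hstart : r'.start = r.start)
    {i : γ.Agent} {t : ℝ≥0} (hND : NDUpTo r'.env t = PND r.env (i, t)) {j : γ.Agent} {s : ℝ≥0}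
    (hjs : Sync r.env (j, s) (i, t))
    (ih : ∀ j' s', s' < s → Sync r.env (j', s') (j, s) →
      Enabled r.env j' s' ∨ Enabled r'.env j' s' → AgreeAt P r r' (j', s')) :
    AgreeAt P r r' (j, s) := by
  have hst : s ≤ t := let ⟨_, hn⟩ := hjs; hn.time_le hr.respectsBounds
  have ihj : ∀ s' < s, Enabled r.env j s' ∨ Enabled r'.env j s' → AgreeAt P r r' (j, s') :=
    fun s' h => ih j s' h (.of_le h.le)
  have hen : ∀ s' < s, Enabled r.env j s' ↔ Enabled r'.env j s' := fun s' h =>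
    ⟨fun he => (ihj s' h (.inl he)).enabled.1 he, fun he => (ihj s' h (.inr he)).enabled.2 he⟩
  have hnd : ∀ (e : Event γ.toNetwork) (s' : ℝ≥0), s' ≤ s → e.agent = j → IsND (e, s') →
      (Occurs r.env (e, s') ↔ Occurs r'.env (e, s')) := by
    rintro e s' hs' rfl hnd
    constructor
    · intro ho
      have : ((e, s') : TimedEvent γ.toNetwork) ∈ NDUpTo r'.env t :=
        hND ▸ ⟨⟨ho, hnd⟩, (Sync.of_le hs').trans hjs⟩
      exact this.1.1
    · intro ho
      have : ((e, s') : TimedEvent γ.toNetwork) ∈ PND r.env (i, t) :=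
        hND ▸ ⟨⟨ho, hnd⟩, hs'.trans hst⟩
      exact this.1.1
  have hsent : ∀ p : Packet γ.toNetwork, p.dst = j → ∀ β : ℝ≥0, γ.bound p.src p.dst = β →
      p.sentAt + β = s → p.sentAt < s → (r.Sent P p ↔ r'.Sent P p) := by
    rintro p rfl β hβ rfl hlt
    have hsync : Sync r.env (p.src, p.sentAt) (p.dst, p.sentAt + β) :=
      ⟨0, (SyncPath.refl _).guarantee p.isLink hβ⟩
    exact ⟨fun h => (ih _ _ hlt hsync (.inl h.1)).sent.1 h,
      fun h => (ih _ _ hlt hsync (.inr h.1)).sent.2 h⟩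
  have hocc : ∀ e : Event γ.toNetwork, e.agent = j →
      (Occurs r.env (e, s) ↔ Occurs r'.env (e, s)) := by
    intro e he
    cases e with
    | input e => exact hnd _ s le_rfl he trivial
    | delivery p =>
      by_cases hp : p.EarlyAt s
      · exact hnd _ s le_rfl he hp
      · constructor
        · intro ho
          obtain ⟨β, hβ, hs⟩ := hr.respectsBounds.bound_eq ho hp
          exact hr.delivered_of_delivered hr' ho hp
            (hsent p he β hβ hs (hr.delivery p s ho).2.1).1
            fun s' hs' hd hearly => (hnd (.delivery p) s' hs'.le he hearly).2 hd
        · intro ho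
          obtain ⟨β, hβ, hs⟩ := hr'.respectsBounds.bound_eq ho hp
          exact hr'.delivered_of_delivered hr ho hp
            (hsent p he β hβ hs (hr'.delivery p s ho).2.1).2
            fun s' hs' hd hearly => (hnd (.delivery p) s' hs'.le he hearly).1 hd
    | ring k =>
      obtain rfl : k = j := he
      refine (hr.timer k s).trans (Iff.trans ?_ (hr'.timer k s).symm)
      refine exists_congr fun t' => and_congr_right fun hlt => and_congr ?_ ?_
      · exact ⟨fun h => (ihj t' hlt (.inl h.1)).setsTimer.1 h,
          fun h => (ihj t' hlt (.inr h.1)).setsTimer.2 h⟩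
      · exact forall_congr' fun a => imp_congr_right fun _ => forall_congr' fun ha =>
          not_congr (hen a ha)
  have hobs : ∀ s' ≤ s, Observes r.env j s' ↔ Observes r'.env j s' := by
    intro s' hs'
    have hocc' : ∀ e : Event γ.toNetwork, e.agent = j →
        (Occurs r.env (e, s') ↔ Occurs r'.env (e, s')) := by
      obtain hlt | rfl := hs'.lt_or_eq
      · intro e he
        exact ⟨fun h => ((ihj s' hlt (.inl (Observes.enabled ⟨e, he, h⟩))).occurs e he).1 h,
          fun h => ((ihj s' hlt (.inr (Observes.enabled ⟨e, he, h⟩))).occurs e he).2 h⟩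
      · exact hocc
    exact exists_congr fun e => and_congr_right fun he => hocc' e he
  have hpre : r.preState j s = r'.preState j s :=
    Run.preState_congr hstart.symm fun s' hs' =>
      hr.state_eq_of_forall hr' fun s'' hs'' => ihj s'' (hs''.trans_lt hs')
  have hact : r.action P j s = r'.action P j s := by
    rw [Run.action, Run.action, hpre, Run.obs_congr hocc]
  have henabled := Enabled.congr hobs
  refine ⟨henabled, hact, ?_, hocc⟩
  by_cases h : Enabled r.env j s
  · exact (hr.state_enabled j s h).trans
      ((congrArg _ hact).trans (hr'.state_enabled j s (henabled.1 h)).symm)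
  · exact (hr.state_idle j s h).trans
      (hpre.trans (hr'.state_idle j s (henabled.not.1 h)).symm)

/-- A run behaves in the syncausal past of `(i, t)` like any run with the same initial states
whose ND events up to `t` are those in the ND past of `(i, t)`. -/
theorem IsRun.agreeAt (hr : IsRun P r) (hr' : IsRun P r') (hstart : r'.start = r.start)
    {i : γ.Agent} {t : ℝ≥0} (hND : NDUpTo r'.env t = PND r.env (i, t)) {θ : γ.Agent × ℝ≥0}
    (hθ : Sync r.env θ (i, t)) : AgreeAt P r r' θ := by
  have hsub : PND r.env (i, t) ⊆ ND r'.env := fun e he => by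
    rw [← hND] at he
    exact he.1
  set B : Set (γ.Agent × ℝ≥0) := {θ | Sync r.env θ (i, t) ∧ ¬ AgreeAt P r r' θ} with hB
  -- A disagreement has an earlier one in its past, but enabled only in one of the two runs, whereas
  -- the regress axiom concerns a single run.
  have hstep : ∀ θ ∈ B, ∃ θ' ∈ B, (Enabled r.env θ'.1 θ'.2 ∨ Enabled r'.env θ'.1 θ'.2) ∧
      θ'.2 < θ.2 ∧ Sync r.env θ' θ := by
    rintro ⟨j, s⟩ ⟨hsync, hbad⟩
    by_contra! hcon
    refine hbad (hr.agreeAt_of_forall hr' hstart hND hsync fun j' s' hlt hs hen => ?_)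
    by_contra hbad'
    exact hcon (j', s') ⟨hs.trans hsync, hbad'⟩ hen hlt hs
  by_contra hbad
  -- Either the descent can always go through pairs enabled in `r`, or below some `θ₀` it uses only
  -- pairs enabled in `r'`. In the second case the syncausal steps of `r` are transferred to `r'`,
  -- as they lie in the past of `(i, t)`.
  by_cases hcase : ∀ θ ∈ B, ∃ θ' ∈ B, Enabled r.env θ'.1 θ'.2 ∧ θ'.2 < θ.2 ∧ Sync r.env θ' θ
  · have hempty : {θ ∈ B | Enabled r.env θ.1 θ.2} = ∅ :=
      hr.noRegress.eq_empty fun θ hθ => ⟨hθ.2,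
        let ⟨θ', h1, h2, h3⟩ := hcase θ hθ.1
        ⟨θ', ⟨h1, h2⟩, h3⟩⟩
    obtain ⟨θ', h1, h2, -⟩ := hcase θ ⟨hθ, hbad⟩
    exact hempty.subset ⟨h1, h2⟩
  · push Not at hcase
    obtain ⟨θ₀, h₀, hno⟩ := hcase
    have hstep' : ∀ θ ∈ B, θ.2 ≤ θ₀.2 → Sync r.env θ θ₀ → ∃ θ' ∈ B,
        Enabled r'.env θ'.1 θ'.2 ∧ θ'.2 < θ.2 ∧ Sync r.env θ' θ := by
      intro θ hθ hle hs
      obtain ⟨θ', h1, h2, h3, h4⟩ := hstep θ hθ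
      exact ⟨θ', h1, h2.resolve_left fun h => hno θ' h1 h (h3.trans_le hle) (h4.trans hs), h3, h4⟩
    have hempty : {θ ∈ B | Enabled r'.env θ.1 θ.2 ∧ θ.2 ≤ θ₀.2 ∧ Sync r.env θ θ₀} = ∅ := by
      refine hr'.noRegress.eq_empty fun θ hθ => ⟨hθ.2.1, ?_⟩
      obtain ⟨θ', h1, h2, h3, h4⟩ := hstep' θ hθ.1 hθ.2.2.1 hθ.2.2.2
      exact ⟨θ', ⟨h1, h2, h3.le.trans hθ.2.2.1, h4.trans hθ.2.2.2⟩, h3,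
        h4.transfer hr.respectsBounds hsub hθ.1.1⟩
    obtain ⟨θ', h1, h2, h3, h4⟩ := hstep' θ₀ h₀ le_rfl ⟨0, .refl _⟩
    exact hempty.subset ⟨h1, h2, h3.le, h4⟩

theorem AgreeUpTo.responds {t : ℝ≥0} (h : AgreeUpTo t r' r) (i : γ.Agent) :
    r'.Responds P i t ↔ r.Responds P i t := by
  have henv : ∀ s ≤ t, r'.env s = r.env s := fun s hs => (h.2 s hs).1
  have hocc : ∀ s ≤ t, ∀ e : Event γ.toNetwork,
      Occurs r'.env (e, s) ↔ Occurs r.env (e, s) := by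
    intro s hs e
    cases e <;> simp only [Occurs, henv s hs]
  have hen : Enabled r'.env i t ↔ Enabled r.env i t :=
    Enabled.congr fun s hs => exists_congr fun e => and_congr_right fun _ => hocc s hs e
  have hact : r'.action P i t = r.action P i t := by
    rw [Run.action, Run.action, Run.obs_congr fun e _ => hocc t le_rfl e,
      Run.preState_congr h.1 fun s hs => (h.2 s hs.le).2 i]
  rw [Run.Responds, Run.Responds, hen, hact]

theorem AgreeUpTo.NDUpTo_eq {t : ℝ≥0} (h : AgreeUpTo t r' r) :
    NDUpTo r'.env t = NDUpTo r.env t := by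
  ext ⟨e, s⟩
  refine ⟨fun ⟨⟨ho, hn⟩, hs⟩ => ⟨⟨?_, hn⟩, hs⟩, fun ⟨⟨ho, hn⟩, hs⟩ => ⟨⟨?_, hn⟩, hs⟩⟩ <;>
    cases e <;> simpa only [Occurs, (h.2 s hs).1] using ho

end Determinism

/-! ### Quiet continuations and chains of ND events -/

section Centipede

variable {γ : Context.{u, v, w, x}} {P : Protocol γ} {inp : γ.Input} {I : Set γ.Agent}

theorem responds_iff (hER : P ∈ ER inp I) {r : Run γ} (hr : r ∈ triggeredRuns P inp)
    {i : γ.Agent} (hi : i ∈ I) {t : ℝ≥0} : r.Responds P i t ↔ t = responseTime P r i := by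
  obtain ⟨t₀, h₀, huniq⟩ := hER.1 r hr i hi
  have hset : {t | r.Responds P i t} = {t₀} :=
    Set.eq_singleton_iff_unique_mem.2 ⟨h₀, huniq⟩
  have ht₀ : responseTime P r i = t₀ := by rw [responseTime, hset, csInf_singleton]
  rw [ht₀]
  exact ⟨huniq t, fun h => h ▸ h₀⟩

/-- When `i` responds, the run may be continued so that the trigger and all early deliveries up to
`d` time units later are in what was the ND past of `i`. -/
theorem exists_continuation (hF : NoForesight P) (hE : NoExtrasensoryPerception P)
    (hER : P ∈ ER inp I) {r : Run γ} (hr : r ∈ triggeredRuns P inp) {i : γ.Agent} (hi : i ∈ I)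
    (d : ℝ≥0) :
    ∃ r' ∈ triggeredRuns P inp, responseTime P r' i = responseTime P r i ∧
      (∃ s ≤ responseTime P r i, inp ∈ (r'.env s).inputs) ∧
      ∀ e ∈ ND r'.env, e.2 < d → e ∈ PND r.env (i, responseTime P r i) := by
  set t := responseTime P r i with ht
  obtain ⟨r₁, hr₁, ⟨hstart, -⟩, hND₁⟩ := hE r hr.1 t i
  obtain ⟨r₂, hr₂, hagree, hin, hearly⟩ := hF r₁ hr₁ t d
  have hresp : r₂.Responds P i t :=
    (hagree.responds i).2 ((IsRun.agreeAt hr.1 hr₁ hstart hND₁ ⟨0, .refl _⟩).responds.1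
      ((responds_iff hER hr hi).2 ht))
  -- The response itself forces the trigger, since nobody in `I` responds in untriggered runs.
  have htrig : r₂ ∈ triggeredRuns P inp := by
    by_contra h
    exact hER.2 r₂ hr₂ h i hi t hresp
  refine ⟨r₂, htrig, ((responds_iff hER htrig hi).1 hresp).symm, ?_, ?_⟩
  · obtain ⟨s, hs⟩ := htrig.2
    refine ⟨s, not_lt.1 fun hlt => ?_, hs⟩
    rw [hin s hlt] at hs
    exact hs
  · rintro ⟨e, s⟩ he hlt
    rw [← hND₁, ← hagree.NDUpTo_eq]
    refine ⟨he, not_lt.1 fun hts => ?_⟩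
    cases e with
    | input e => exact (hin s hts).subset he.1
    | delivery p =>
      -- An early delivery after `t` takes at least `d`, so it occurs no earlier than time `d`.
      exact hlt.not_ge (le_add_self.trans (hearly s hts p he.1 he.2))
    | ring => exact he.2

/-- If the trigger were outside the ND past of the response, it could be deleted without `i`
noticing. The quiet continuation contains a trigger by the response time; it belongs to that past,
and it is the trigger of `r` because inputs occur at most once. -/
theorem input_mem_PND (hF : NoForesight P) (hE : NoExtrasensoryPerception P)
    (hER : P ∈ ER inp I) {r : Run γ} (hr : r ∈ triggeredRuns P inp) {s : ℝ≥0}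
    (hs : inp ∈ (r.env s).inputs) {i : γ.Agent} (hi : i ∈ I) :
    ((Event.input inp, s) : TimedEvent γ.toNetwork) ∈ PND r.env (i, responseTime P r i) := by
  obtain ⟨r', -, -, ⟨s', hs', hin⟩, hND⟩ :=
    exists_continuation hF hE hER hr hi (responseTime P r i + 1)
  have hmem := hND (.input inp, s') ⟨hin, trivial⟩ (hs'.trans_lt (lt_add_one _))
  obtain rfl := hr.1.input_once inp s s' hs hmem.1.1
  exact hmem

/-- If the response times in `J` differ by at most `D` in all triggered runs, then for every
sequence of agents in `J` there is a chain of ND events, backwards from the trigger to the response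
of the first agent, whose members guarantee the successive agents in time. -/
theorem exists_centipede (hF : NoForesight P) (hE : NoExtrasensoryPerception P)
    (hER : P ∈ ER inp I) {J : Set γ.Agent} (hJ : J ⊆ I) {D : ℝ≥0}
    (hD : ∀ r ∈ triggeredRuns P inp, ∀ j ∈ J, ∀ k ∈ J,
      responseTime P r k ≤ responseTime P r j + D)
    (M : ℕ) {r : Run γ} (hr : r ∈ triggeredRuns P inp) {s : ℝ≥0} (hs : inp ∈ (r.env s).inputs)
    (σ : ℕ → γ.Agent) (hσ : ∀ k, σ k ∈ J) :
    ∃ (e : ℕ → TimedEvent γ.toNetwork) (τ : ℕ → ℝ≥0),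
      (∀ k ≤ M, e k ∈ PND r.env (σ 0, responseTime P r (σ 0)) ∧
        EventSync r.env (.input inp, s) (e k) ∧ Guar (e k).node (σ k, τ k)) ∧
      (∀ k < M, EventSync r.env (e (k + 1)) (e k)) ∧
      (∀ k ≤ M, τ k ≤ responseTime P r (σ 0) + k * D) ∧
      ((∀ r₁ ∈ triggeredRuns P inp, ∀ r₂ ∈ triggeredRuns P inp, ∀ j ∈ J, ∀ k ∈ J,
          (responseTime P r₁ k : ℝ) - responseTime P r₁ j =
            responseTime P r₂ k - responseTime P r₂ j) →
        ∀ k ≤ M, τ k = responseTime P r (σ k)) := by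
  induction M generalizing r s σ with
  | zero =>
    obtain ⟨hin, n, hn⟩ := input_mem_PND hF hE hER hr hs (hJ (hσ 0))
    obtain ⟨e, he, hse, hg⟩ := hn.exists_last_ND (IsRun.respectsBounds hr.1) hin
    refine ⟨fun _ => e, fun _ => responseTime P r (σ 0), ?_, ?_, ?_, ?_⟩
    · intro k hk
      obtain rfl := Nat.le_zero.1 hk
      exact ⟨⟨he, 0, hg.syncPath⟩, hse, hg⟩
    · exact fun k hk => absurd hk (Nat.not_lt_zero k)
    · exact fun k _ => le_self_add
    · intro _ k hk
      rw [Nat.le_zero.1 hk]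
  | succ M ih =>
    set t := responseTime P r (σ 0) with ht
    -- In `r'` the agent `σ 1` responds by `t + D`; the extra `1` makes its whole past strictly
    -- earlier than the quiet horizon.
    obtain ⟨r', hr', hrt, ⟨s', -, hin⟩, hND⟩ :=
      exists_continuation hF hE hER hr (hJ (hσ 0)) (t + D + 1)
    have hB : RespectsBounds r.env := IsRun.respectsBounds hr.1
    have hB' : RespectsBounds r'.env := IsRun.respectsBounds hr'.1
    have ht' : responseTime P r' (σ 1) ≤ t + D :=
      (hD r' hr' _ (hσ 0) _ (hσ 1)).trans_eq (congrArg (· + D) hrt)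
    have hsub : PND r'.env (σ 1, responseTime P r' (σ 1)) ⊆ PND r.env (σ 0, t) := by
      rintro e ⟨he, n, hn⟩
      exact hND e he ((hn.time_le hB').trans_lt (ht'.trans_lt (lt_add_one _)))
    have hsub' : PND r'.env (σ 1, responseTime P r' (σ 1)) ⊆ ND r.env :=
      fun e he => (hsub he).1
    obtain rfl : s = s' := hr.1.input_once inp _ _ hs
      (hsub (input_mem_PND hF hE hER hr' hin (hJ (hσ 1)))).1.1
    obtain ⟨e, τ, he, hee, hτ, hrigid⟩ := ih hr' hin (fun k => σ (k + 1)) fun k => hσ (k + 1)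
    have he0 := hsub (he 0 (Nat.zero_le _)).1
    -- The chain built in `r'` starts in the past of `(σ 0, t)` in `r`. The last ND event on a path
    -- from there to `(σ 0, t)` is prepended, with `τ 0 = t`.
    obtain ⟨e₀, he₀, hse, hg⟩ := he0.2.choose_spec.exists_last_ND hB he0.1
    refine ⟨fun k => k.casesOn e₀ e, fun k => k.casesOn t τ, ?_, ?_, ?_, ?_⟩
    · rintro (_ | k) hk
      · have h0 := (he 0 (Nat.zero_le _)).2.1.transfer hB' hsub' (he 0 (Nat.zero_le _)).1
        refine ⟨⟨he₀, 0, hg.syncPath⟩, ?_, hg⟩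
        obtain heq | ⟨p, hp, hsp⟩ := hse
        · exact heq ▸ h0
        · exact .inr ⟨p, hp, (h0.sync he0.1).trans hsp⟩
      · obtain ⟨h1, h2, h3⟩ := he k (Nat.le_of_succ_le_succ hk)
        exact ⟨hsub h1, h2.transfer hB' hsub' h1, h3⟩
    · rintro (_ | k) hk
      · exact hse
      · exact (hee k (Nat.lt_of_succ_lt_succ hk)).transfer hB' hsub'
          (he k (Nat.lt_of_succ_lt_succ hk).le).1
    · rintro (_ | k) hk
      · exact le_self_add
      · refine (hτ k (Nat.le_of_succ_le_succ hk)).trans ((add_le_add_left ht' _).trans ?_)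
        push_cast
        exact le_of_eq (by ring)
    · rintro h (_ | k) hk
      · rfl
      · refine (hrigid h k (Nat.le_of_succ_le_succ hk)).trans (NNReal.coe_injective ?_)
        -- `σ 0` responds at the same time in `r'` and `r`, so equal differences make all response
        -- times in `J` equal.
        have := h r' hr' r hr _ (hσ 0) _ (hσ (k + 1))
        rw [hrt, ← ht] at this
        simpa using this

end Centipede

/-! ### Pigeonhole on the chain and cyclic enumeration of agents -/

/-- A sequence without a constant block of length `m + 1` among its first `L` blocks yields a path
through `L` ND events. -/
theorem exists_constant_block {N : Network.{u, v, w}} {E : Env N} {θ : N.Agent × ℝ≥0} {L m : ℕ}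
    {a : TimedEvent N} {e : ℕ → TimedEvent N} (hbound : ∀ n, SyncPath E n a.node θ → n < L)
    (he : ∀ k ≤ L * m, e k ∈ PND E θ ∧ EventSync E a (e k))
    (hchain : ∀ k < L * m, EventSync E (e (k + 1)) (e k)) :
    ∃ q < L, ∀ k ≤ m, e (q * m + k) = e (q * m) := by
  by_contra! hcon
  -- The chain runs backwards in the index: prolonging a path from `e l` to start at `e k` never
  -- loses ND events, and gains one as soon as `e k` differs from `e l`.
  have hpath : ∀ k ≤ L * m, ∀ l ≤ k, ∀ n, SyncPath E n (e l).node θ →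
      ∃ n' ≥ n, SyncPath E n' (e k).node θ ∧ (e k ≠ e l → n < n') := by
    intro k hk l hl
    induction k, hl using Nat.le_induction with
    | base => exact fun n hn => ⟨n, le_rfl, hn, fun h => absurd rfl h⟩
    | succ k hlk ih =>
      intro n hn
      obtain ⟨n', hn', hp, hlt⟩ := ih (Nat.le_of_succ_le hk) n hn
      by_cases heq : e (k + 1) = e k
      · rw [heq]
        exact ⟨n', hn', hp, hlt⟩
      · obtain ⟨c, hc⟩ := (hchain k hk).exists_syncPath heq (he k (Nat.le_of_succ_le hk)).1.1
        exact ⟨_, by omega, hc.trans hp, fun _ => by omega⟩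
  have hcount : ∀ q ≤ L, ∃ n ≥ q, SyncPath E n (e (q * m)).node θ := by
    intro q hq
    induction q with
    | zero =>
      obtain ⟨n, hn⟩ := (he 0 (Nat.zero_le _)).1.2
      exact ⟨n, Nat.zero_le _, by simpa using hn⟩
    | succ q ih =>
      obtain ⟨n, hn, hp⟩ := ih (Nat.le_of_succ_le hq)
      obtain ⟨k, hk, hne⟩ := hcon q hq
      have hend : (q + 1) * m ≤ L * m := Nat.mul_le_mul_right m hq
      have hmid : q * m + k ≤ (q + 1) * m := by rw [Nat.succ_mul]; omega
      obtain ⟨n₁, -, hp₁, hlt⟩ := hpath _ (hmid.trans hend) _ (Nat.le_add_right _ k) n hp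
      obtain ⟨n₂, hn₂, hp₂, -⟩ := hpath _ hend _ hmid n₁ hp₁
      exact ⟨n₂, by have := hlt hne; omega, hp₂⟩
  -- One gain per block gives `L` early deliveries after the trigger, while `hbound` allows fewer
  -- than `L`.
  obtain ⟨n, hn, hp⟩ := hcount L le_rfl
  obtain ⟨c, hc⟩ := (he (L * m) le_rfl).2.sync (he (L * m) le_rfl).1.1
  have := hbound _ (hc.trans hp)
  omega

/-- A sequence through a finite set such that any `card` consecutive terms cover the set. -/
theorem exists_cyclic_sequence {α : Type*} (J : Finset α) {i : α} (hi : i ∈ J) :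
    ∃ σ : ℕ → α, σ 0 = i ∧ (∀ k, σ k ∈ J) ∧ ∀ q, ∀ j ∈ J, ∃ k < J.card, σ (q + k) = j := by
  have hpos : 0 < J.card := Finset.card_pos.2 ⟨i, hi⟩
  set φ := J.equivFin
  let σ : ℕ → α := fun k => φ.symm ⟨(k + φ ⟨i, hi⟩) % J.card, Nat.mod_lt _ hpos⟩
  have hσ : ∀ k, σ k ∈ J := fun k => Subtype.property _
  refine ⟨σ, ?_, hσ, fun q j hj => ?_⟩
  · simp only [σ, zero_add, Nat.mod_eq_of_lt (φ ⟨i, hi⟩).2, Fin.eta, Equiv.symm_apply_apply]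
  -- Consecutive indices are distinct modulo `J.card`, so a full window is injective, hence onto `J`
  -- by counting.
  · have hinj : Set.InjOn (fun k => σ (q + k)) (Finset.range J.card) := by
      intro k hk l hl h
      have h1 := φ.symm.injective (Subtype.ext h)
      have h2 : q + k + (φ ⟨i, hi⟩ : ℕ) ≡ q + l + φ ⟨i, hi⟩ [MOD J.card] := congrArg Fin.val h1
      have h3 : k ≡ l [MOD J.card] := (h2.add_right_cancel' _).add_left_cancel' _
      exact h3.eq_of_lt_of_lt (Finset.mem_range.1 hk) (Finset.mem_range.1 hl)
    obtain ⟨k, hk, hkj⟩ := Finset.surjOn_of_injOn_of_card_le (t := J) _ (fun k _ => hσ _) hinj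
      (by simp) hj
    exact ⟨k, Finset.mem_range.1 hk, hkj⟩

/-! ### From chains to brooms -/

section Broom

variable {γ : Context.{u, v, w, x}} {P : Protocol γ} {inp : γ.Input} {I : Set γ.Agent}

theorem exists_broom (hF : NoForesight P) (hE : NoExtrasensoryPerception P)
    (hER : P ∈ ER inp I) {J : Finset I} {D : ℝ≥0}
    (hD : ∀ r ∈ triggeredRuns P inp, ∀ j ∈ J, ∀ k ∈ J,
      responseTime P r k ≤ responseTime P r j + D)
    {r : Run γ} (hr : r ∈ triggeredRuns P inp) {s : ℝ≥0} (hs : inp ∈ (r.env s).inputs)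
    {i : I} (hi : i ∈ J) {L : ℕ}
    (hL : pathCountFrom r.env (.input inp, s) (i, responseTime P r i) = L) :
    ∃ e ∈ PND r.env (i, responseTime P r i), ∃ τ : I → ℝ≥0,
      IsBroom r.env inp (fun j : I => (j : γ.Agent)) (J : Set I) τ e ∧
      (∀ j ∈ J, (τ j : ℝ) ≤ responseTime P r i + ((J.card : ℝ) - 1) * L * D) ∧
      ((∀ r₁ ∈ triggeredRuns P inp, ∀ r₂ ∈ triggeredRuns P inp, ∀ j ∈ J, ∀ k ∈ J,
          (responseTime P r₁ k : ℝ) - responseTime P r₁ j =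
            responseTime P r₂ k - responseTime P r₂ j) →
        ∀ j ∈ J, τ j = responseTime P r j) := by
  have hsync : Sync r.env (TimedEvent.node (.input inp, s)) (i, responseTime P r i) :=
    (input_mem_PND hF hE hER hr hs i.2).2
  have hbound : ∀ n, SyncPath r.env n (TimedEvent.node (.input inp, s))
      (i, responseTime P r i) → n < L := by
    intro n hn
    rw [pathCountFrom, pathCount, if_pos hsync] at hL
    have h1 : (n : ℕ∞) ≤ ⨆ n : {n : ℕ // SyncPath r.env n (TimedEvent.node (.input inp, s))
        ((i : γ.Agent), responseTime P r i)}, ((n : ℕ) : ℕ∞) :=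
      le_iSup (fun n : {n : ℕ // SyncPath r.env n (TimedEvent.node (.input inp, s))
        ((i : γ.Agent), responseTime P r i)} => ((n : ℕ) : ℕ∞)) ⟨n, hn⟩
    -- The trigger is counted in `L` but not in `n`; this makes the bound strict.
    have h2 : ((1 + n : ℕ) : ℕ∞) ≤ L := by
      rw [← hL]
      push_cast
      exact add_le_add_right h1 1
    have := Nat.cast_le.1 h2
    omega
  obtain ⟨σ, h0, hσ, hcover⟩ := exists_cyclic_sequence J hi
  obtain ⟨m, hm⟩ : ∃ m, J.card = m + 1 :=
    Nat.exists_eq_succ_of_ne_zero (Finset.card_ne_zero_of_mem hi)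
  have hmemJ : ∀ a ∈ ((↑) : I → γ.Agent) '' (J : Set I), ∃ b ∈ J, (b : γ.Agent) = a :=
    fun a ha => ha
  obtain ⟨e, τ, he, hchain, hτ, hrigid⟩ := exists_centipede hF hE hER
    (J := ((↑) : I → γ.Agent) '' (J : Set I)) (Subtype.coe_image_subset I _) (D := D)
    (by rintro r hr _ ⟨j, hj, rfl⟩ _ ⟨k, hk, rfl⟩; exact hD r hr j hj k hk)
    -- With `m = |J| - 1`, adjacent blocks share an endpoint, so `L` blocks of `|J|` agents need
    -- only `L * m` steps; hence the factor `(|J| - 1) * L` in the horizon.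
    (L * m) hr hs (fun k => σ k) fun k => ⟨_, hσ k, rfl⟩
  simp only [h0] at he hτ
  obtain ⟨q, hq, hconst⟩ := exists_constant_block hbound
    (fun k hk => ⟨(he k hk).1, (he k hk).2.1⟩) hchain
  have hblock : ∀ k ≤ m, q * m + k ≤ L * m := fun k hk =>
    calc q * m + k ≤ (q + 1) * m := by rw [Nat.succ_mul]; omega
      _ ≤ L * m := Nat.mul_le_mul_right m hq
  choose! κ hκ hκσ using hcover (q * m)
  have hκm : ∀ j ∈ J, κ j ≤ m := fun j hj => Nat.lt_succ_iff.1 ((hκ j hj).trans_eq hm)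
  have hq0 := he (q * m) (hblock 0 (Nat.zero_le _))
  refine ⟨e (q * m), hq0.1, fun j => τ (q * m + κ j),
    ⟨hq0.1.1, ⟨s, hs, hq0.2.1⟩, fun j hj => ?_⟩, fun j hj => ?_, fun h j hj => ?_⟩
  · have := (he _ (hblock _ (hκm j hj))).2.2
    rwa [hconst _ (hκm j hj), hκσ j hj] at this
  · have h1 := hτ _ (hblock _ (hκm j hj))
    have h2 : (τ (q * m + κ j) : ℝ) ≤ responseTime P r i + ((q * m + κ j : ℕ) : ℝ) * D := by
      exact_mod_cast h1
    have h3 : ((q * m + κ j : ℕ) : ℝ) ≤ (m : ℝ) * L := by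
      rw [mul_comm (m : ℝ)]
      exact_mod_cast hblock _ (hκm j hj)
    have h4 : ((J.card : ℝ) - 1) = m := by rw [hm]; push_cast; ring
    rw [h4]
    exact h2.trans (add_le_add_right (mul_le_mul_of_nonneg_right h3 D.2) _)
  · have := hrigid (by
      rintro r₁ hr₁ r₂ hr₂ _ ⟨j, hj, rfl⟩ _ ⟨k, hk, rfl⟩
      exact h r₁ hr₁ r₂ hr₂ j hj k hk) _ (hblock _ (hκm j hj))
    rwa [hκσ j hj] at this

/-! ### Canonical forms of constraining functions -/

theorem PathLen.implements {ι : Type*} {δ : Spec ι} {T : ι → ℝ≥0} (hT : Implements δ T) {i j : ι}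
    {ℓ : EReal} (h : PathLen δ i j ℓ) : ((T j : ℝ) : EReal) ≤ ((T i : ℝ) : EReal) + ℓ := by
  induction h with
  | single => simp
  | cons hne _ _ ih =>
    rw [← add_assoc]
    exact ih.trans (add_le_add_left (hT _ _ hne) _)

theorem PathLen.ne_top {ι : Type*} {δ : Spec ι} {i j : ι} {ℓ : EReal} (h : PathLen δ i j ℓ) :
    ℓ ≠ ⊤ := by
  induction h with
  | single => exact EReal.zero_ne_top
  | cons _ htop _ ih => exact EReal.add_ne_top htop ih

theorem sub_le_canon {ι : Type*} {δ : Spec ι} {T : ι → ℝ≥0} (hT : Implements δ T) (i j : ι) :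
    (((T j : ℝ) - T i : ℝ) : EReal) ≤ canon δ i j := by
  refine le_sInf fun ℓ hℓ => ?_
  rw [EReal.coe_sub]
  exact EReal.sub_le_of_le_add' (hℓ.implements hT)

/-- A path keeps the distance below `⊤`; an implementation, which bounds it from below, keeps it
above `⊥`. -/
theorem exists_canon_eq {ι : Type*} {δ : Spec ι} {T : ι → ℝ≥0} (hT : Implements δ T) {i j : ι}
    (h : ∃ ℓ, PathLen δ i j ℓ) : ∃ c : ℝ, canon δ i j = c := by
  obtain ⟨ℓ, hℓ⟩ := h
  have htop : canon δ i j ≠ ⊤ := ((sInf_le hℓ).trans_lt (lt_top_iff_ne_top.2 hℓ.ne_top)).ne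
  have hbot : canon δ i j ≠ ⊥ := fun hb => by
    have := sub_le_canon hT i j
    rw [hb] at this
    exact EReal.coe_ne_bot _ (le_bot_iff.1 this)
  exact ⟨_, (EReal.coe_toReal htop hbot).symm⟩

theorem exists_broom_of_TCR (hF : NoForesight P) (hE : NoExtrasensoryPerception P) {δ : Spec I}
    (hP : P ∈ TCR inp I δ) {r : Run γ} (hr : r ∈ runs P) {s : ℝ≥0}
    (hs : inp ∈ (r.env s).inputs) {J : Finset I} (hJ : InOneComponent δ (J : Set I))
    {i : I} (hi : i ∈ J) {L : ℕ}
    (hL : pathCountFrom r.env (.input inp, s) ((i : γ.Agent), responseTime P r i) = (L : ℕ∞)) :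
    ∃ e ∈ PND r.env ((i : γ.Agent), responseTime P r i),
      (∃ (D : ℝ) (τ : I → ℝ≥0),
        IsGreatest {d : EReal | ∃ j ∈ J, ∃ k ∈ J, d = canon δ j k} (D : EReal) ∧
        IsBroom r.env inp (fun j : I => (j : γ.Agent)) (J : Set I) τ e ∧
        ∀ j ∈ J, (τ j : ℝ) ≤ (responseTime P r i : ℝ) + ((J.card : ℝ) - 1) * (L : ℝ) * D) ∧
      ((∀ j ∈ J, ∀ k ∈ J, canon δ j k = -canon δ k j) →
        IsBroom r.env inp (fun j : I => (j : γ.Agent)) (J : Set I)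
          (fun j => responseTime P r j) e) := by
  have htrig : r ∈ triggeredRuns P inp := ⟨hr, s, hs⟩
  have hreal : ∀ j ∈ J, ∀ k ∈ J, ∃ c : ℝ, canon δ j k = c := fun j hj k hk =>
    exists_canon_eq (hP.2 r htrig) (hJ j hj k hk)
  choose! c hc using hreal
  have hle : ∀ r' ∈ triggeredRuns P inp, ∀ j ∈ J, ∀ k ∈ J,
      (responseTime P r' k : ℝ) - responseTime P r' j ≤ c j k := by
    intro r' hr' j hj k hk
    have := sub_le_canon (hP.2 r' hr') j k
    rw [hc j hj k hk] at this
    exact EReal.coe_le_coe_iff.1 this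
  obtain ⟨⟨j₀, k₀⟩, hmem, hmax⟩ :=
    (J ×ˢ J).exists_max_image (fun p => c p.1 p.2) ⟨(i, i), Finset.mk_mem_product hi hi⟩
  obtain ⟨hj₀, hk₀⟩ := Finset.mem_product.1 hmem
  have hmax' : ∀ j ∈ J, ∀ k ∈ J, c j k ≤ c j₀ k₀ := fun j hj k hk =>
    hmax (j, k) (Finset.mk_mem_product hj hk)
  -- The diagonal value at `i` is already nonnegative, because a triggered run implements `δ`.
  have hpos : 0 ≤ c j₀ k₀ := by
    have := (hle r htrig i hi i hi).trans (hmax' i hi i hi)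
    rwa [sub_self] at this
  lift c j₀ k₀ to ℝ≥0 using hpos with D hDeq
  obtain ⟨e, he, τ, hbroom, hτ, hrigid⟩ := exists_broom hF hE hP.1 (D := D)
    (fun r' hr' j hj k hk => by
      have := (hle r' hr' j hj k hk).trans (hmax' j hj k hk)
      rw [← NNReal.coe_le_coe, NNReal.coe_add]
      linarith) htrig hs hi hL
  refine ⟨e, he, ⟨D, τ, ⟨⟨j₀, hj₀, k₀, hk₀, ?_⟩, ?_⟩, hbroom, hτ⟩, fun hanti => ?_⟩
  · rw [hDeq, hc j₀ hj₀ k₀ hk₀]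
  · rintro _ ⟨j, hj, k, hk, rfl⟩
    rw [hc j hj k hk]
    exact EReal.coe_le_coe_iff.2 (hmax' j hj k hk)
  · have hc' : ∀ j ∈ J, ∀ k ∈ J, c j k = -c k j := by
      intro j hj k hk
      have := hanti j hj k hk
      rw [hc j hj k hk, hc k hk j hj] at this
      exact_mod_cast this
    -- Antisymmetry turns the upper bounds for `(j, k)` and `(k, j)` into an equality, so the
    -- differences do not depend on the run.
    have hdiff : ∀ r' ∈ triggeredRuns P inp, ∀ j ∈ J, ∀ k ∈ J,
        (responseTime P r' k : ℝ) - responseTime P r' j = c j k := by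
      intro r' hr' j hj k hk
      have h1 := hle r' hr' j hj k hk
      have h2 := hle r' hr' k hk j hj
      have h3 := hc' j hj k hk
      linarith
    have heq := hrigid fun r₁ hr₁ r₂ hr₂ j hj k hk =>
      (hdiff r₁ hr₁ j hj k hk).trans (hdiff r₂ hr₂ j hj k hk).symm
    refine ⟨hbroom.1, hbroom.2.1, fun j hj => ?_⟩
    have hg := hbroom.2.2 j hj
    rwa [heq j hj] at hg

/-! ### Prescribed time differences and the two broom theorems -/

/-- The constraining function that prescribes the time differences of `T`. -/
def differenceSpec {ι : Type*} (T : ι → ℝ≥0) : Spec ι :=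
  fun i j _ => (((T j : ℝ) - T i : ℝ) : EReal)

theorem PathLen.eq_sub {ι : Type*} {T : ι → ℝ≥0} {i j : ι} {ℓ : EReal}
    (h : PathLen (differenceSpec T) i j ℓ) : ℓ = (((T j : ℝ) - T i : ℝ) : EReal) := by
  induction h with
  | single => simp
  | cons _ _ _ ih =>
    rw [ih, differenceSpec, ← EReal.coe_add]
    congr 1
    ring

theorem pathLen_differenceSpec {ι : Type*} (T : ι → ℝ≥0) (i j : ι) :
    PathLen (differenceSpec T) i j (((T j : ℝ) - T i : ℝ) : EReal) := by
  by_cases h : i = j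
  · subst h
    simpa using PathLen.single (δ := differenceSpec T) i
  · simpa [differenceSpec] using
      PathLen.cons (δ := differenceSpec T) h (EReal.coe_ne_top _) (.single j)

theorem canon_differenceSpec {ι : Type*} (T : ι → ℝ≥0) (i j : ι) :
    canon (differenceSpec T) i j = (((T j : ℝ) - T i : ℝ) : EReal) :=
  le_antisymm (sInf_le (pathLen_differenceSpec T i j)) (le_sInf fun _ h => h.eq_sub.ge)

theorem TTR_subset_TCR (T : I → ℝ≥0) :
    (TTR inp I T : Set (Protocol γ)) ⊆ TCR inp I (differenceSpec T) := by
  refine fun P hP => ⟨hP.1, fun r hr i j _ => ?_⟩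
  have := hP.2 r hr i j
  rw [differenceSpec, ← EReal.coe_add, EReal.coe_le_coe_iff]
  linarith

theorem exists_broom_of_TTR (hF : NoForesight P) (hE : NoExtrasensoryPerception P)
    (hγ : BoundedSyncausalPath γ) {T : I → ℝ≥0} (hI : I.Finite) (hP : P ∈ TTR inp I T)
    {r : Run γ} (hr : r ∈ triggeredRuns P inp) :
    ∃ e, IsBroom r.env inp (fun i : γ.Agent => i) I (fun i => responseTime P r i) e := by
  obtain ⟨hrun, s, hs⟩ := hr
  obtain rfl | ⟨i, hi⟩ := I.eq_empty_or_nonempty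
  -- Without agents there is no response to start from; the trigger itself is a broom.
  · exact ⟨(.input inp, s), ⟨hs, trivial⟩, ⟨s, hs, .inl rfl⟩, fun _ h => h.elim⟩
  have := hI.fintype
  have hsync := (input_mem_PND hF hE hP.1 ⟨hrun, s, hs⟩ hs hi).2
  have hfin : pathCountFrom r.env (.input inp, s) (i, responseTime P r i) ≠ ⊤ :=
    WithTop.add_ne_top.2 ⟨ENat.one_ne_top, (hγ P r hrun _ _ hsync).ne⟩
  obtain ⟨L, hL⟩ := ENat.ne_top_iff_exists.1 hfin
  obtain ⟨e, -, -, hb⟩ := exists_broom_of_TCR hF hE (TTR_subset_TCR T hP) hrun hs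
    (J := Finset.univ) (i := ⟨i, hi⟩) (fun j _ k _ => ⟨_, pathLen_differenceSpec T j k⟩)
    (Finset.mem_univ _) hL.symm
  obtain ⟨h1, h2, h3⟩ := hb fun j _ k _ => by
    rw [canon_differenceSpec, canon_differenceSpec, ← EReal.coe_neg, neg_sub]
  exact ⟨e, h1, h2, fun j hj => h3 ⟨j, hj⟩ (Finset.mem_coe.2 (Finset.mem_univ _))⟩

theorem SR_subset_TTR : (SR inp I : Set (Protocol γ)) ⊆ TTR inp I fun _ => 0 :=
  fun P hP => ⟨hP.1, fun r hr i j => by rw [hP.2 r hr i i.2 j j.2, sub_self, sub_self]⟩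

end Broom

end TimelyResponse

theorem mainTheorem9 (γ : TimelyResponse.Context)
    (P : TimelyResponse.Protocol γ)
    (hForesight : TimelyResponse.NoForesight P)
    (hPerception : TimelyResponse.NoExtrasensoryPerception P)
    (inp : γ.Input) :
    -- the two parts of the main claim
    (∀ (I : Set γ.Agent) (δ : TimelyResponse.Spec I), P ∈ TimelyResponse.TCR inp I δ →
      ∀ r ∈ TimelyResponse.runs P, ∀ s : ℝ≥0, inp ∈ (r.env s).inputs →
      ∀ J : Finset I, TimelyResponse.InOneComponent δ (J : Set I) →
      ∀ i ∈ J, ∀ L : ℕ,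
        TimelyResponse.pathCountFrom r.env (TimelyResponse.Event.input inp, s)
          ((i : γ.Agent), TimelyResponse.responseTime P r i) = (L : ℕ∞) →
      ∃ e ∈ TimelyResponse.PND r.env ((i : γ.Agent), TimelyResponse.responseTime P r i),
        (∃ (D : ℝ) (τ : I → ℝ≥0),
          IsGreatest {d : EReal | ∃ j ∈ J, ∃ k ∈ J, d = TimelyResponse.canon δ j k} (D : EReal) ∧
          TimelyResponse.IsBroom r.env inp (fun j : I => (j : γ.Agent)) (J : Set I) τ e ∧
          ∀ j ∈ J, (τ j : ℝ) ≤
            (TimelyResponse.responseTime P r i : ℝ) + ((J.card : ℝ) - 1) * (L : ℝ) * D) ∧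
        ((∀ j ∈ J, ∀ k ∈ J, TimelyResponse.canon δ j k = -TimelyResponse.canon δ k j) →
          TimelyResponse.IsBroom r.env inp (fun j : I => (j : γ.Agent)) (J : Set I)
            (fun j => TimelyResponse.responseTime P r j) e)) ∧
    -- the broom theorem in continuous time
    (TimelyResponse.BoundedSyncausalPath γ →
      ∀ I : Set γ.Agent, I.Finite → P ∈ TimelyResponse.SR inp I →
      ∀ r ∈ TimelyResponse.triggeredRuns P inp, ∀ t : ℝ≥0,
        (∀ i ∈ I, TimelyResponse.responseTime P r i = t) →
        ∃ e, TimelyResponse.IsBroom r.env inp (fun i : γ.Agent => i) I (fun _ => t) e) ∧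
    -- the uneven broom theorem in continuous time
    (TimelyResponse.BoundedSyncausalPath γ →
      ∀ (I : Set γ.Agent) (T : I → ℝ≥0), I.Finite → P ∈ TimelyResponse.TTR inp I T →
      ∀ r ∈ TimelyResponse.triggeredRuns P inp,
        ∃ e, TimelyResponse.IsBroom r.env inp (fun i : γ.Agent => i) I
          (fun i => TimelyResponse.responseTime P r i) e) := by
  refine ⟨fun I δ hP r hr s hs J hJ i hi L hL =>
      TimelyResponse.exists_broom_of_TCR hForesight hPerception hP hr hs hJ hi hL,
    fun hγ I hI hP r hr t ht => ?_,
    fun hγ I T hI hP r hr =>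
      TimelyResponse.exists_broom_of_TTR hForesight hPerception hγ hI hP hr⟩
  obtain ⟨e, h1, h2, h3⟩ := TimelyResponse.exists_broom_of_TTR hForesight hPerception hγ hI
    (TimelyResponse.SR_subset_TTR hP) hr
  exact ⟨e, h1, h2, fun j hj => ht j hj ▸ h3 j hj⟩
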